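/- Let $m,n,t$ be nonnegative integers with $t\le\min\{m,n\}$. Let $M_{m,n}$ be the set of complex $m\times n$ matrices, and let $B^+_\ell$ and $B^-_\ell$ be the subgroups of $GL_\ell(\mathbb C)$ consisting of the upper, respectively lower, triangular matrices. A partial permutation in $M_{m,n}$ is a $0,1$-matrix $w$ with at most one nonzero entry in each row and each column; its domain $\operatorname{dom}(w)\subseteq\{1,\dots,n\}$ is the set of indices of its nonzero columns, and its range $\operatorname{rng}(w)\subseteq\{1,\dots,m\}$ is the set of indices of its nonzero rows. For sets of integers $I=\{i_1<\dots<i_t\}$ and $J=\{j_1<\dots<j_t\}$, write $I\le J$ (equivalently $J\ge I$) if $i_l\le j_l$ for $l=1,\dots,t$. Let $w_1,w_2\in M_{m,n}$ be partial permutations of rank $t$. Then the generalized double Bruhat cell $$B^+_m w_1 B^+_n\cap B^-_m w_2 B^-_n$$ is nonempty if and only if $$\operatorname{dom}(w_1)\le\operatorname{dom}(w_2)\quad\text{and}\quad \operatorname{rng}(w_1)\ge\operatorname{rng}(w_2).$$ -/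

import Mathlib

namespace DoubleBruhat

open Matrix

/-- A partial permutation matrix: a `0,1`-matrix with at most one nonzero entry in each row
and in each column. -/
structure IsPartialPerm {m n : ℕ} (w : Matrix (Fin m) (Fin n) ℂ) : Prop where
  zero_or_one : ∀ i j, w i j = 0 ∨ w i j = 1
  row_unique : ∀ i j j', w i j ≠ 0 → w i j' ≠ 0 → j = j'
  col_unique : ∀ i i' j, w i j ≠ 0 → w i' j ≠ 0 → i = i'

open Classical in
/-- The domain of a partial permutation: the indices of its nonzero columns. As a function,
`w` sends `j` in its domain to the row `i` with `w i j = 1`. -/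
noncomputable def dom {m n : ℕ} (w : Matrix (Fin m) (Fin n) ℂ) : Finset (Fin n) :=
  Finset.univ.filter fun j => ∃ i, w i j = 1

open Classical in
/-- The range of a partial permutation: the indices of its nonzero rows. -/
noncomputable def rng {m n : ℕ} (w : Matrix (Fin m) (Fin n) ℂ) : Finset (Fin m) :=
  Finset.univ.filter fun i => ∃ j, w i j = 1

/-- For two subsets `I = {i₁ < ⋯ < iₜ}` and `J = {j₁ < ⋯ < jₜ}` of the same size:
`iₗ ≤ jₗ` for all `l`. -/
def SubsetLE {N : ℕ} (I J : Finset (Fin N)) : Prop :=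
  ∃ h : I.card = J.card, ∀ l : Fin I.card,
    I.orderEmbOfFin rfl l ≤ J.orderEmbOfFin h.symm l

/-- The Borel subgroup of upper triangular matrices in `GL_ℓ(ℂ)`. -/
def borelPlus (l : ℕ) : Subgroup (GL (Fin l) ℂ) where
  carrier := {g | ∀ i j, j < i → (g : Matrix (Fin l) (Fin l) ℂ) i j = 0}
  one_mem' := fun i j hij => by simp [Matrix.one_apply_ne hij.ne']
  mul_mem' := fun {a b} ha hb => by
    have ha' : (a : Matrix (Fin l) (Fin l) ℂ).BlockTriangular id := fun i j h => ha i j h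
    have hb' : (b : Matrix (Fin l) (Fin l) ℂ).BlockTriangular id := fun i j h => hb i j h
    exact fun i j h => (ha'.mul hb') h
  inv_mem' := fun {a} ha => by
    have ha' : (a : Matrix (Fin l) (Fin l) ℂ).BlockTriangular id := fun i j h => ha i j h
    have : Invertible (a : Matrix (Fin l) (Fin l) ℂ) := a.isUnit.invertible
    intro i j h
    rw [Matrix.coe_units_inv]
    exact (Matrix.blockTriangular_inv_of_blockTriangular ha') h

/-- The Borel subgroup of lower triangular matrices in `GL_ℓ(ℂ)`. -/
def borelMinus (l : ℕ) : Subgroup (GL (Fin l) ℂ) where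
  carrier := {g | ∀ i j, i < j → (g : Matrix (Fin l) (Fin l) ℂ) i j = 0}
  one_mem' := fun i j hij => by simp [Matrix.one_apply_ne hij.ne]
  mul_mem' := fun {a b} ha hb => by
    have ha' : (a : Matrix (Fin l) (Fin l) ℂ).BlockTriangular OrderDual.toDual :=
      fun i j h => ha i j h
    have hb' : (b : Matrix (Fin l) (Fin l) ℂ).BlockTriangular OrderDual.toDual :=
      fun i j h => hb i j h
    exact fun i j h => (ha'.mul hb') (OrderDual.toDual_lt_toDual.2 h)
  inv_mem' := fun {a} ha => by
    have ha' : (a : Matrix (Fin l) (Fin l) ℂ).BlockTriangular OrderDual.toDual :=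
      fun i j h => ha i j h
    have : Invertible (a : Matrix (Fin l) (Fin l) ℂ) := a.isUnit.invertible
    intro i j h
    rw [Matrix.coe_units_inv]
    exact (Matrix.blockTriangular_inv_of_blockTriangular ha') (OrderDual.toDual_lt_toDual.2 h)

/-- The double coset `H w K` in `M_{m,n}(ℂ)`, for subgroups `H` of `GL_m` and `K` of `GL_n`. -/
def cosetOf {m n : ℕ} (H : Subgroup (GL (Fin m) ℂ)) (w : Matrix (Fin m) (Fin n) ℂ)
    (K : Subgroup (GL (Fin n) ℂ)) : Set (Matrix (Fin m) (Fin n) ℂ) :=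
  {x | ∃ g ∈ H, ∃ k ∈ K,
    x = (g : Matrix (Fin m) (Fin m) ℂ) * w * (k : Matrix (Fin n) (Fin n) ℂ)}

/-- The generalized double Bruhat cell `B⁺_m w₁ B⁺_n ∩ B⁻_m w₂ B⁻_n`. -/
def cell {m n : ℕ} (w₁ w₂ : Matrix (Fin m) (Fin n) ℂ) : Set (Matrix (Fin m) (Fin n) ℂ) :=
  cosetOf (borelPlus m) w₁ (borelPlus n) ∩ cosetOf (borelMinus m) w₂ (borelMinus n)

end DoubleBruhat

namespace DoubleBruhat

open Matrix

/-! ### Counting and the order on subsets -/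

/-! Necessity is a rank count. Left multiplication by a lower triangular matrix sends top rows into
combinations of top rows, so for `x` in the cell the rows up to `k` have rank at most the number of
elements of `rng w₂` up to `k`. Dually, the rows beyond `k` have rank at most the number of elements
of `rng w₁` beyond `k`. These bounds add up to at least `x.rank = (rng w₁).card`, which compares the
counts up to each `k` (`subsetLE_rng_of_cell_nonempty`). Transposition gives the domains.

Sufficiency reduces to `GL_t`. Deleting zero rows and columns writes `wᵢ` as `incl aᵢ * Sᵢ * (incl
cᵢ)ᵀ` with `Sᵢ` an invertible `t × t` matrix. The cell of `S₁`, `S₂` is nonempty because `B⁺ S₁ B⁺`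
meets `B⁻` and `B⁻ S₂ B⁻` meets `B⁺` (`exists_doubleBruhat`). The order conditions then allow `incl
a₁` and `incl a₂` to be moved to one common matrix, by an upper and a lower triangular matrix
respectively (`shear_mul_incl`); likewise for the columns. -/

lemma subsetLE_iff {N t : ℕ} {I J : Finset (Fin N)} (hI : I.card = t) (hJ : J.card = t) :
    SubsetLE I J ↔ ∀ l : Fin t, I.orderEmbOfFin hI l ≤ J.orderEmbOfFin hJ l := by
  subst hI
  exact ⟨fun ⟨_, h⟩ => h, fun h => ⟨hJ.symm, h⟩⟩

lemma subsetLE_of_card_filter_le {N : ℕ} {I J : Finset (Fin N)} (h : I.card = J.card)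
    (hc : ∀ k, (J.filter (· ≤ k)).card ≤ (I.filter (· ≤ k)).card) : SubsetLE I J := by
  rw [subsetLE_iff h rfl]
  intro l
  by_contra! hlt
  -- Cutting at the offending element of `J`: with `l` counted from `0`, `J` has at least `l + 1`
  -- elements up to `k`, and `I` at most `l`.
  set k := J.orderEmbOfFin rfl l with hk
  have h1 : ((Finset.Iic l).map (J.orderEmbOfFin rfl).toEmbedding).card ≤
      (J.filter (· ≤ k)).card := by
    apply Finset.card_le_card
    intro x hx
    obtain ⟨a, ha, rfl⟩ := Finset.mem_map.1 hx
    simp only [RelEmbedding.coe_toEmbedding, Finset.mem_filter, Finset.orderEmbOfFin_mem, true_and]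
    exact (J.orderEmbOfFin rfl).monotone (Finset.mem_Iic.1 ha)
  have h2 : (I.filter (· ≤ k)).card ≤
      ((Finset.Iio l).map (I.orderEmbOfFin h).toEmbedding).card := by
    apply Finset.card_le_card
    intro x hx
    obtain ⟨hxI, hxk⟩ := Finset.mem_filter.1 hx
    have : x ∈ Set.range (I.orderEmbOfFin h) := by
      rw [Finset.range_orderEmbOfFin]; exact hxI
    obtain ⟨a, rfl⟩ := this
    refine Finset.mem_map.2 ⟨a, Finset.mem_Iio.2 ?_, rfl⟩
    exact (I.orderEmbOfFin h).lt_iff_lt.1 (lt_of_le_of_lt hxk hlt)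
  have h3 := hc k
  rw [Finset.card_map, Fin.card_Iic] at h1
  rw [Finset.card_map, Fin.card_Iio] at h2
  omega

/-! ### Inclusion matrices -/

/-- The matrix whose `l`-th column is the standard basis vector indexed by `a l`. -/
noncomputable def incl {N t : ℕ} (a : Fin t → Fin N) : Matrix (Fin N) (Fin t) ℂ :=
  (1 : Matrix (Fin N) (Fin N) ℂ).submatrix id a

lemma incl_apply {N t : ℕ} (a : Fin t → Fin N) (i : Fin N) (l : Fin t) :
    incl a i l = if i = a l then 1 else 0 := by
  simp [incl, Matrix.one_apply]

lemma mul_incl {M N t : ℕ} (a : Fin t → Fin N) (g : Matrix (Fin M) (Fin N) ℂ) :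
    g * incl a = g.submatrix id a := by
  ext i l
  simp [Matrix.mul_apply, incl_apply]

lemma transpose_incl_mul {M N t : ℕ} (a : Fin t → Fin N) (g : Matrix (Fin N) (Fin M) ℂ) :
    (incl a)ᵀ * g = g.submatrix a id := by
  ext i l
  simp [Matrix.mul_apply, incl_apply]

lemma transpose_incl_mul_incl {N t : ℕ} {a : Fin t → Fin N} (ha : Function.Injective a) :
    (incl a)ᵀ * incl a = 1 := by
  rw [transpose_incl_mul]
  ext i j
  simp [incl_apply, Matrix.one_apply, ha.eq_iff]

/-! ### Triangular matrices -/

lemma mem_cosetOf_plus {m n : ℕ} {w : Matrix (Fin m) (Fin n) ℂ} {g : Matrix (Fin m) (Fin m) ℂ}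
    {k : Matrix (Fin n) (Fin n) ℂ} (hg : g.BlockTriangular id) (hk : k.BlockTriangular id)
    (hg' : IsUnit g) (hk' : IsUnit k) :
    g * w * k ∈ cosetOf (borelPlus m) w (borelPlus n) :=
  ⟨hg'.unit, fun _ _ h => hg h, hk'.unit, fun _ _ h => hk h, rfl⟩

lemma mem_cosetOf_minus {m n : ℕ} {w : Matrix (Fin m) (Fin n) ℂ} {g : Matrix (Fin m) (Fin m) ℂ}
    {k : Matrix (Fin n) (Fin n) ℂ} (hg : gᵀ.BlockTriangular id) (hk : kᵀ.BlockTriangular id)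
    (hg' : IsUnit g) (hk' : IsUnit k) :
    g * w * k ∈ cosetOf (borelMinus m) w (borelMinus n) :=
  ⟨hg'.unit, fun _ _ h => hg h, hk'.unit, fun _ _ h => hk h, rfl⟩

lemma isUnit_transpose' {N : ℕ} {A : Matrix (Fin N) (Fin N) ℂ} (h : IsUnit A) : IsUnit Aᵀ :=
  (Matrix.isUnit_transpose A).2 h

lemma isUnit_of_upper {N : ℕ} {A : Matrix (Fin N) (Fin N) ℂ} (h : A.BlockTriangular id)
    (hd : ∀ i, A i i ≠ 0) : IsUnit A := by
  rw [Matrix.isUnit_iff_isUnit_det, Matrix.det_of_isUpperTriangular h, isUnit_iff_ne_zero]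
  exact Finset.prod_ne_zero_iff.2 fun i _ => hd i

/-- The matrix acting as `b` on the coordinates in the image of `a` and as the identity on the
other ones. -/
noncomputable def extend {N t : ℕ} (a : Fin t → Fin N) (b : Matrix (Fin t) (Fin t) ℂ) :
    Matrix (Fin N) (Fin N) ℂ :=
  incl a * b * (incl a)ᵀ + (1 - incl a * (incl a)ᵀ)

lemma extend_transpose {N t : ℕ} (a : Fin t → Fin N) (b : Matrix (Fin t) (Fin t) ℂ) :
    (extend a b)ᵀ = extend a bᵀ := by
  simp [extend, Matrix.mul_assoc]

/-- This lets `t × t` factors be moved past `incl a` and absorbed into the large triangular groups.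
-/
lemma extend_mul_incl {N t : ℕ} {a : Fin t → Fin N} (ha : Function.Injective a)
    (b : Matrix (Fin t) (Fin t) ℂ) : extend a b * incl a = incl a * b := by
  simp [extend, Matrix.add_mul, Matrix.sub_mul, Matrix.mul_assoc, transpose_incl_mul_incl ha]

lemma transpose_incl_mul_extend {N t : ℕ} {a : Fin t → Fin N} (ha : Function.Injective a)
    (b : Matrix (Fin t) (Fin t) ℂ) : (incl a)ᵀ * extend a b = b * (incl a)ᵀ := by
  have := congrArg Matrix.transpose (extend_mul_incl ha bᵀ)
  simpa [extend_transpose] using this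

lemma extend_mul_extend {N t : ℕ} {a : Fin t → Fin N} (ha : Function.Injective a)
    (b c : Matrix (Fin t) (Fin t) ℂ) : extend a b * extend a c = extend a (b * c) := by
  conv_lhs => rw [extend.eq_1 a c]
  rw [Matrix.mul_add, Matrix.mul_sub, ← Matrix.mul_assoc, ← Matrix.mul_assoc, ← Matrix.mul_assoc,
    extend_mul_incl ha, Matrix.mul_one, extend, extend]
  simp only [Matrix.mul_assoc]
  abel

lemma isUnit_extend {N t : ℕ} {a : Fin t → Fin N} (ha : Function.Injective a)
    {b : Matrix (Fin t) (Fin t) ℂ} (hb : IsUnit b) : IsUnit (extend a b) := by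
  obtain ⟨u, rfl⟩ := hb
  refine IsUnit.of_mul_eq_one (extend a (↑u⁻¹ : Matrix (Fin t) (Fin t) ℂ)) ?_
  rw [extend_mul_extend ha, u.mul_inv]
  simp [extend]

lemma extend_upper {N t : ℕ} {a : Fin t → Fin N} (ha : StrictMono a)
    {b : Matrix (Fin t) (Fin t) ℂ} (hb : b.BlockTriangular id) :
    (extend a b).BlockTriangular id := by
  intro i j hij
  have hij' : j < i := hij
  have h1 : (incl a * b * (incl a)ᵀ) i j = 0 := by
    rw [Matrix.mul_apply]
    refine Finset.sum_eq_zero fun k _ => ?_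
    rw [Matrix.mul_apply, Finset.sum_mul]
    refine Finset.sum_eq_zero fun l _ => ?_
    simp only [Matrix.transpose_apply, incl_apply]
    split_ifs with h h'
    · subst h h'
      simp [hb (show id k < id l from ha.lt_iff_lt.1 hij')]
    all_goals simp
  have h2 : (incl a * (incl a)ᵀ) i j = 0 := by
    rw [Matrix.mul_apply]
    refine Finset.sum_eq_zero fun k _ => ?_
    simp only [Matrix.transpose_apply, incl_apply]
    split_ifs with h h'
    · subst h h'
      exact absurd hij' (lt_irrefl _)
    all_goals simp
  simp [extend, h1, h2, Matrix.one_apply_ne hij'.ne']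

open Classical in
/-- The matrix with ones on the diagonal and at the places `(b l, a l)`. -/
noncomputable def shear {N t : ℕ} (a b : Fin t → Fin N) : Matrix (Fin N) (Fin N) ℂ :=
  Matrix.of fun i j => if i = j ∨ ∃ l, j = a l ∧ i = b l then 1 else 0

/-- Column `l` of either side has ones exactly at `a l` and `b l`, a description symmetric in `a`
and `b`. -/
lemma shear_mul_incl {N t : ℕ} {a b : Fin t → Fin N} (ha : Function.Injective a)
    (hb : Function.Injective b) : shear a b * incl a = shear b a * incl b := by
  rw [mul_incl, mul_incl]
  ext i l
  simp only [shear, Matrix.submatrix_apply, Matrix.of_apply, id]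
  congr 1
  simp only [ha.eq_iff, hb.eq_iff, exists_eq_left', or_comm]

lemma shear_upper {N t : ℕ} {a b : Fin t → Fin N} (h : ∀ l, b l ≤ a l) :
    (shear a b).BlockTriangular id := by
  intro i j hij
  have hij' : j < i := hij
  simp only [shear, Matrix.of_apply, ite_eq_right_iff, one_ne_zero, imp_false, not_or, not_exists,
    not_and]
  refine ⟨hij'.ne', ?_⟩
  rintro l rfl rfl
  exact absurd (h l) hij'.not_ge

lemma shear_lower {N t : ℕ} {a b : Fin t → Fin N} (h : ∀ l, a l ≤ b l) :
    (shear a b)ᵀ.BlockTriangular id := by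
  intro i j hij
  have hij' : j < i := hij
  simp only [shear, Matrix.transpose_apply, Matrix.of_apply, ite_eq_right_iff, one_ne_zero,
    imp_false, not_or, not_exists, not_and]
  refine ⟨hij'.ne, ?_⟩
  rintro l rfl rfl
  exact absurd (h l) hij'.not_ge

lemma shear_diag {N t : ℕ} (a b : Fin t → Fin N) (i : Fin N) : shear a b i i ≠ 0 := by
  simp [shear]

lemma isUnit_shear_upper {N t : ℕ} {a b : Fin t → Fin N} (h : ∀ l, b l ≤ a l) :
    IsUnit (shear a b) :=
  isUnit_of_upper (shear_upper h) (shear_diag a b)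

lemma isUnit_shear_lower {N t : ℕ} {a b : Fin t → Fin N} (h : ∀ l, a l ≤ b l) :
    IsUnit (shear a b) :=
  (Matrix.isUnit_transpose _).1 (isUnit_of_upper (shear_lower h) (shear_diag a b))

/-! ### Every invertible matrix is upper times lower times upper triangular -/

/-- The block matrix with blocks `1`, `0`, `0`, `b`. -/
noncomputable def consOne {N : ℕ} (b : Matrix (Fin N) (Fin N) ℂ) :
    Matrix (Fin (N + 1)) (Fin (N + 1)) ℂ :=
  Matrix.of (Fin.cons (Fin.cons 1 0) fun i => Fin.cons 0 (b i))

lemma consOne_upper {N : ℕ} {b : Matrix (Fin N) (Fin N) ℂ} (hb : b.BlockTriangular id) :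
    (consOne b).BlockTriangular id := by
  intro i j hij
  have hij' : j < i := hij
  induction i using Fin.cases with
  | zero => exact absurd hij' (Fin.not_lt_zero _)
  | succ i =>
    induction j using Fin.cases with
    | zero => simp [consOne]
    | succ j => simpa [consOne] using hb (show id j < id i from Fin.succ_lt_succ_iff.1 hij')

lemma isUnit_consOne {N : ℕ} {b : Matrix (Fin N) (Fin N) ℂ} (hb : IsUnit b) :
    IsUnit (consOne b) := by
  rw [Matrix.isUnit_iff_isUnit_det] at hb ⊢
  have : (consOne b).det = b.det := by
    rw [Matrix.det_succ_row_zero, Fin.sum_univ_succ]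
    have : (consOne b).submatrix Fin.succ Fin.succ = b := by
      ext i j; simp [consOne]
    simp [consOne] at this ⊢
    simp [this]
  rwa [this]

/-- Gaussian elimination by induction on size: make the corner entry nonzero, clear the rest of the
first row, and recurse on the complementary block. -/
lemma exists_upper_mul_mul_upper_eq_lower {N : ℕ} (A : Matrix (Fin N) (Fin N) ℂ)
    (hA : IsUnit A) : ∃ b u : Matrix (Fin N) (Fin N) ℂ, b.BlockTriangular id ∧
      u.BlockTriangular id ∧ IsUnit b ∧ IsUnit u ∧ (b * A * u)ᵀ.BlockTriangular id := by
  induction N with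
  | zero => exact ⟨1, 1, fun i => i.elim0, fun i => i.elim0, isUnit_one, isUnit_one,
      fun i => i.elim0⟩
  | succ N ih =>
    obtain ⟨b₀, hb₀, hb₀', hne⟩ : ∃ b₀ : Matrix (Fin (N + 1)) (Fin (N + 1)) ℂ,
        b₀.BlockTriangular id ∧ IsUnit b₀ ∧ (b₀ * A) 0 0 ≠ 0 := by
      by_cases h0 : A 0 0 = 0
      · obtain ⟨i, hi⟩ : ∃ i, A i 0 ≠ 0 := by
          by_contra! h
          rw [Matrix.isUnit_iff_isUnit_det, Matrix.det_eq_zero_of_column_eq_zero 0 h] at hA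
          simp at hA
        have hi0 : (0 : Fin (N + 1)) ≠ i := by rintro rfl; exact hi h0
        -- Adding a lower row to row `0` is an upper triangular operation.
        refine ⟨Matrix.transvection 0 i 1, ?_, ?_, ?_⟩
        · exact Matrix.blockTriangular_transvection (b := id) (Fin.zero_le i) 1
        · rw [Matrix.isUnit_iff_isUnit_det, Matrix.det_transvection_of_ne _ _ hi0]
          exact isUnit_one
        · simpa [h0] using hi
      · exact ⟨1, Matrix.blockTriangular_one, isUnit_one, by simpa using h0⟩
    set C := b₀ * A with hC
    have hCu : IsUnit C := hb₀'.mul hA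
    -- Right multiplication by `u₀` subtracts multiples of column `0` to clear the rest of row `0`.
    let u₀ : Matrix (Fin (N + 1)) (Fin (N + 1)) ℂ :=
      Matrix.of (Fin.cons (Fin.cons 1 fun j => -(C 0 j.succ / C 0 0))
        fun i => (1 : Matrix (Fin (N + 1)) (Fin (N + 1)) ℂ) i.succ)
    have hu₀ : u₀.BlockTriangular id := by
      intro i j hij
      have hij' : j < i := hij
      induction i using Fin.cases with
      | zero => exact absurd hij' (Fin.not_lt_zero _)
      | succ i => simpa [u₀] using Matrix.one_apply_ne hij'.ne'
    have hu₀' : IsUnit u₀ := by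
      refine isUnit_of_upper hu₀ fun i => ?_
      induction i using Fin.cases with
      | zero => simp [u₀]
      | succ i => simp [u₀]
    set D := C * u₀ with hD
    have hDu : IsUnit D := hCu.mul hu₀'
    have hD0 : ∀ j : Fin N, D 0 j.succ = 0 := by
      intro j
      rw [hD, Matrix.mul_apply, Fin.sum_univ_succ]
      simp [u₀, Matrix.one_apply]
      field_simp
      ring
    have hA' : IsUnit (D.submatrix Fin.succ Fin.succ) := by
      rw [Matrix.isUnit_iff_isUnit_det] at hDu ⊢
      rw [Matrix.det_succ_row_zero, Fin.sum_univ_succ] at hDu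
      simp only [hD0] at hDu
      simp at hDu
      rw [isUnit_iff_ne_zero]
      simpa using hDu.2
    obtain ⟨b, u, hb, hu, hb', hu', hl⟩ := ih _ hA'
    refine ⟨consOne b * b₀, u₀ * consOne u, (consOne_upper hb).mul hb₀,
      hu₀.mul (consOne_upper hu), (isUnit_consOne hb').mul hb₀', hu₀'.mul (isUnit_consOne hu'), ?_⟩
    have he : consOne b * b₀ * A * (u₀ * consOne u) = consOne b * D * consOne u := by
      simp only [hD, hC, Matrix.mul_assoc]
    rw [he]
    intro i j hij
    have hij' : j < i := hij
    induction i using Fin.cases with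
    | zero => exact absurd hij' (Fin.not_lt_zero _)
    | succ i =>
      rw [Matrix.transpose_apply]
      induction j using Fin.cases with
      | zero =>
        rw [Matrix.mul_apply, Fin.sum_univ_succ]
        simp [consOne, Matrix.mul_apply, Fin.sum_univ_succ, hD0]
      | succ j =>
        have := hl (show id j < id i from Fin.succ_lt_succ_iff.1 hij')
        rw [Matrix.transpose_apply, Matrix.mul_apply] at this
        rw [Matrix.mul_apply, Fin.sum_univ_succ, ← this]
        simp [consOne, Matrix.mul_apply, Fin.sum_univ_succ, hD0]

/-- The double Bruhat cell of two invertible matrices is nonempty. -/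
lemma exists_doubleBruhat {t : ℕ} (S₁ S₂ : Matrix (Fin t) (Fin t) ℂ) (h₁ : IsUnit S₁)
    (h₂ : IsUnit S₂) : ∃ b₁ u₁ b₂ u₂ : Matrix (Fin t) (Fin t) ℂ,
      b₁.BlockTriangular id ∧ u₁.BlockTriangular id ∧ b₂ᵀ.BlockTriangular id ∧
      u₂ᵀ.BlockTriangular id ∧ IsUnit b₁ ∧ IsUnit u₁ ∧ IsUnit b₂ ∧ IsUnit u₂ ∧
      b₁ * S₁ * u₁ = b₂ * S₂ * u₂ := by
  obtain ⟨b, u, hb, hu, hb', hu', hl⟩ := exists_upper_mul_mul_upper_eq_lower S₁ h₁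
  obtain ⟨c, v, hc, hv, hc', hv', hl'⟩ :=
    exists_upper_mul_mul_upper_eq_lower S₂ᵀ (isUnit_transpose' h₂)
  have e : (c * S₂ᵀ * v)ᵀ = vᵀ * S₂ * cᵀ := by simp [Matrix.mul_assoc]
  rw [e] at hl'
  -- The common element is the product of the lower triangular `b * S₁ * u` and the upper triangular
  -- `vᵀ * S₂ * cᵀ`; each factor is absorbed into a Borel element on one side.
  refine ⟨b, u * (vᵀ * S₂ * cᵀ), b * S₁ * u * vᵀ, cᵀ, hb, hu.mul hl', ?_, by simpa using hc, hb',
    hu'.mul (((isUnit_transpose' hv').mul h₂).mul (isUnit_transpose' hc')),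
    ((hb'.mul h₁).mul hu').mul (isUnit_transpose' hv'), isUnit_transpose' hc', ?_⟩
  · rw [Matrix.transpose_mul, Matrix.transpose_transpose]
    exact hv.mul hl
  · simp only [Matrix.mul_assoc]

/-! ### Partial permutation matrices -/

section PartialPerm

variable {m n : ℕ} {w : Matrix (Fin m) (Fin n) ℂ}

lemma mem_dom {j : Fin n} : j ∈ dom w ↔ ∃ i, w i j = 1 := by simp [dom]

lemma mem_rng {i : Fin m} : i ∈ rng w ↔ ∃ j, w i j = 1 := by simp [rng]

lemma IsPartialPerm.mem_of_ne_zero (hw : IsPartialPerm w) {i : Fin m} {j : Fin n}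
    (h : w i j ≠ 0) : i ∈ rng w ∧ j ∈ dom w :=
  have h1 := (hw.zero_or_one i j).resolve_left h
  ⟨mem_rng.2 ⟨j, h1⟩, mem_dom.2 ⟨i, h1⟩⟩

lemma IsPartialPerm.transpose (hw : IsPartialPerm w) : IsPartialPerm wᵀ :=
  ⟨fun i j => hw.zero_or_one j i, fun i j j' => hw.col_unique j j' i,
    fun i i' j => hw.row_unique j i i'⟩

lemma rng_transpose : rng wᵀ = dom w := by
  ext; simp [mem_dom, mem_rng]

lemma IsPartialPerm.card_rng_eq_card_dom (hw : IsPartialPerm w) :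
    (rng w).card = (dom w).card := by
  choose f hf using fun i (hi : i ∈ rng w) => mem_rng.1 hi
  refine Finset.card_bij f (fun i hi => mem_dom.2 ⟨i, hf i hi⟩) ?_ ?_
  · intro i hi i' hi' e
    refine hw.col_unique i i' (f i hi) (by simp [hf i hi]) ?_
    rw [e, hf i' hi']
    exact one_ne_zero
  · intro j hj
    obtain ⟨i, hi⟩ := mem_dom.1 hj
    have hir : i ∈ rng w := mem_rng.2 ⟨j, hi⟩
    exact ⟨i, hir, hw.row_unique i _ _ (by simp [hf i hir]) (by simp [hi])⟩

lemma IsPartialPerm.eq_incl_mul (hw : IsPartialPerm w) {t s : ℕ} (hr : (rng w).card = t)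
    (hd : (dom w).card = s) :
    w = incl ((rng w).orderEmbOfFin hr) *
      w.submatrix ((rng w).orderEmbOfFin hr) ((dom w).orderEmbOfFin hd) *
        (incl ((dom w).orderEmbOfFin hd))ᵀ := by
  set a := (rng w).orderEmbOfFin hr
  set c := (dom w).orderEmbOfFin hd
  ext i j
  have key : ∀ l k, incl a i l * w (a l) (c k) * incl c j k =
      if i = a l then if j = c k then w i j else 0 else 0 := by
    intro l k
    simp only [incl_apply]
    split_ifs with h h'
    · simp [h, h']
    all_goals simp
  simp only [Matrix.mul_apply, Finset.sum_mul, Matrix.transpose_apply, Matrix.submatrix_apply, key]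
  by_cases h : w i j = 0
  · simp [h]
  · obtain ⟨hi, hj⟩ := hw.mem_of_ne_zero h
    obtain ⟨l, rfl⟩ : i ∈ Set.range a := by rw [Finset.range_orderEmbOfFin]; exact hi
    obtain ⟨k, rfl⟩ : j ∈ Set.range c := by rw [Finset.range_orderEmbOfFin]; exact hj
    simp [a.injective.eq_iff, c.injective.eq_iff]

lemma IsPartialPerm.isUnit_submatrix (hw : IsPartialPerm w) {t : ℕ} (hr : (rng w).card = t)
    (hd : (dom w).card = t) :
    IsUnit (w.submatrix ((rng w).orderEmbOfFin hr) ((dom w).orderEmbOfFin hd)) := by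
  set a := (rng w).orderEmbOfFin hr with ha
  set c := (dom w).orderEmbOfFin hd with hc
  -- The rows of the compressed matrix are distinct standard basis vectors, so its transpose is its
  -- inverse.
  refine IsUnit.of_mul_eq_one (w.submatrix a c)ᵀ ?_
  ext l l'
  obtain ⟨j, hj⟩ := mem_rng.1 ((rng w).orderEmbOfFin_mem hr l)
  obtain ⟨k, rfl⟩ : j ∈ Set.range c := by
    rw [Finset.range_orderEmbOfFin]; exact mem_dom.2 ⟨_, hj⟩
  rw [← ha] at hj
  rw [Matrix.mul_apply, Finset.sum_eq_single k]
  · simp only [Matrix.submatrix_apply, Matrix.transpose_apply, hj, one_mul]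
    rcases eq_or_ne l l' with rfl | hne
    · rw [hj, Matrix.one_apply_eq]
    · rw [Matrix.one_apply_ne hne]
      by_contra h
      exact hne (a.injective (hw.col_unique _ _ _ (by simp [hj]) h))
  · intro k' _ hk'
    have : w (a l) (c k') = 0 := by
      by_contra h
      exact hk' (c.injective (hw.row_unique _ _ _ h (by simp [hj])))
    simp [this]
  · simp

/-- Compressing `w` to its invertible block and expanding it back are both multiplications, so
neither raises the rank. -/
lemma IsPartialPerm.card_dom_eq_rank (hw : IsPartialPerm w) : (dom w).card = w.rank := by
  have hr := hw.card_rng_eq_card_dom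
  have hu := Matrix.rank_of_isUnit _ (hw.isUnit_submatrix hr rfl)
  rw [Fintype.card_fin] at hu
  apply le_antisymm
  · conv_lhs => rw [← hu]
    have e : w.submatrix ((rng w).orderEmbOfFin hr) ((dom w).orderEmbOfFin rfl) =
        (incl ((rng w).orderEmbOfFin hr))ᵀ * w * incl ((dom w).orderEmbOfFin rfl) := by
      rw [transpose_incl_mul, mul_incl, Matrix.submatrix_submatrix]
      rfl
    rw [e]
    exact (Matrix.rank_mul_le_left _ _).trans (Matrix.rank_mul_le_right _ _)
  · conv_lhs => rw [hw.eq_incl_mul hr rfl]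
    refine (Matrix.rank_mul_le_left _ _).trans ((Matrix.rank_mul_le_right _ _).trans hu.le)

lemma IsPartialPerm.card_rng_eq_rank (hw : IsPartialPerm w) : (rng w).card = w.rank :=
  hw.card_rng_eq_card_dom.trans hw.card_dom_eq_rank

end PartialPerm

/-! ### Nonempty cells satisfy the order conditions -/

section Necessity

variable {m n : ℕ} {w : Matrix (Fin m) (Fin n) ℂ}

/-- The coordinate projection onto the indices satisfying `p`. -/
noncomputable def proj {N : ℕ} (p : Fin N → Prop) [DecidablePred p] : Matrix (Fin N) (Fin N) ℂ :=
  Matrix.diagonal fun i => if p i then 1 else 0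

lemma IsPartialPerm.rank_proj_mul_le (hw : IsPartialPerm w) (p : Fin m → Prop)
    [DecidablePred p] : (proj p * w).rank ≤ ((rng w).filter p).card := by
  have e : proj p * w = proj (fun i => i ∈ (rng w).filter p) * w := by
    ext i j
    by_cases h : w i j = 0
    · simp [proj, h]
    · simp [proj, (hw.mem_of_ne_zero h).1]
  rw [e]
  refine (Matrix.rank_mul_le_left _ _).trans ?_
  rw [proj, Matrix.rank_diagonal, Fintype.card_subtype]
  exact Finset.card_le_card fun i hi => by simpa using hi

/-- The condition on `g` says that the rows of `g * w` selected by `p` combine only rows of `w`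
selected by `p`. Initial segments suit lower triangular `g`, final segments upper triangular `g`. -/
lemma IsPartialPerm.rank_proj_mul_mul_mul_le (hw : IsPartialPerm w) (p : Fin m → Prop)
    [DecidablePred p] {g : Matrix (Fin m) (Fin m) ℂ} (hg : ∀ i j, p i → ¬ p j → g i j = 0)
    (k : Matrix (Fin n) (Fin n) ℂ) :
    (proj p * (g * w * k)).rank ≤ ((rng w).filter p).card := by
  have e : proj p * g = proj p * g * proj p := by
    ext i j
    rw [proj, Matrix.mul_diagonal, Matrix.diagonal_mul]
    by_cases hi : p i <;> by_cases hj : p j <;> simp [hi, hj]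
    exact hg i j hi hj
  have e' : proj p * (g * w * k) = proj p * g * (proj p * w * k) := by
    calc _ = proj p * g * (w * k) := by simp only [Matrix.mul_assoc]
      _ = proj p * g * proj p * (w * k) := by rw [← e]
      _ = _ := by simp only [Matrix.mul_assoc]
  rw [e']
  exact (Matrix.rank_mul_le_right _ _).trans
    ((Matrix.rank_mul_le_left _ _).trans (hw.rank_proj_mul_le p))

lemma matrix_rank_add_le (A B : Matrix (Fin m) (Fin n) ℂ) :
    (A + B).rank ≤ A.rank + B.rank := by
  rw [Matrix.rank, Matrix.rank, Matrix.rank, Matrix.mulVecLin_add]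
  exact (Submodule.finrank_mono (LinearMap.range_add_le _ _)).trans
    (Submodule.finrank_add_le_finrank_add_finrank _ _)

lemma rank_eq_of_mem_cosetOf {x : Matrix (Fin m) (Fin n) ℂ} {H : Subgroup (GL (Fin m) ℂ)}
    {K : Subgroup (GL (Fin n) ℂ)} (hx : x ∈ cosetOf H w K) : x.rank = w.rank := by
  obtain ⟨g, -, k, -, rfl⟩ := hx
  rw [Matrix.rank_mul_eq_left_of_isUnit_det _ _ ((Matrix.isUnit_iff_isUnit_det _).1 k.isUnit),
    Matrix.rank_mul_eq_right_of_isUnit_det _ _ ((Matrix.isUnit_iff_isUnit_det _).1 g.isUnit)]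

lemma subsetLE_rng_of_cell_nonempty {w₁ w₂ : Matrix (Fin m) (Fin n) ℂ} (hw₁ : IsPartialPerm w₁)
    (hw₂ : IsPartialPerm w₂) (h : (cell w₁ w₂).Nonempty) : SubsetLE (rng w₂) (rng w₁) := by
  obtain ⟨x, hx₁, hx₂⟩ := h
  have hc₁ := hw₁.card_rng_eq_rank.trans (rank_eq_of_mem_cosetOf hx₁).symm
  have hc₂ := hw₂.card_rng_eq_rank.trans (rank_eq_of_mem_cosetOf hx₂).symm
  refine subsetLE_of_card_filter_le (hc₂.trans hc₁.symm) fun k => ?_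
  have htop : (proj (· ≤ k) * x).rank ≤ ((rng w₂).filter (· ≤ k)).card := by
    obtain ⟨g, hg, l, -, rfl⟩ := hx₂
    exact hw₂.rank_proj_mul_mul_mul_le _
      (fun i j hi hj => hg i j (lt_of_le_of_lt hi (not_le.1 hj))) _
  have hbot : (proj (fun i => ¬ i ≤ k) * x).rank ≤ ((rng w₁).filter (fun i => ¬ i ≤ k)).card := by
    obtain ⟨g, hg, l, -, rfl⟩ := hx₁
    exact hw₁.rank_proj_mul_mul_mul_le _
      (fun i j hi hj => hg i j (lt_of_le_of_lt (not_not.1 hj) (not_le.1 hi))) _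
  have hsum : proj (· ≤ k) * x + proj (fun i => ¬ i ≤ k) * x = x := by
    ext i j
    by_cases hi : i ≤ k <;> simp [proj, hi]
  have hrank := matrix_rank_add_le (proj (· ≤ k) * x) (proj (fun i => ¬ i ≤ k) * x)
  rw [hsum] at hrank
  have := Finset.card_filter_add_card_filter_not (s := rng w₁) (· ≤ k)
  omega

/-- Transposition exchanges upper and lower triangular matrices, which is why `w₁` and `w₂` trade
places and the inequality for domains is opposite to that for ranges. -/
lemma cell_transpose_nonempty {w₁ w₂ : Matrix (Fin m) (Fin n) ℂ} (h : (cell w₁ w₂).Nonempty) :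
    (cell w₂ᵀ w₁ᵀ).Nonempty := by
  obtain ⟨x, ⟨g, hg, k, hk, rfl⟩, g', hg', k', hk', e⟩ := h
  refine ⟨((g : Matrix (Fin m) (Fin m) ℂ) * w₁ * (k : Matrix (Fin n) (Fin n) ℂ))ᵀ, ?_, ?_⟩
  · rw [e, Matrix.transpose_mul, Matrix.transpose_mul, ← Matrix.mul_assoc]
    exact mem_cosetOf_plus (fun _ _ h => hk' _ _ h) (fun _ _ h => hg' _ _ h)
      (isUnit_transpose' k'.isUnit) (isUnit_transpose' g'.isUnit)
  · rw [Matrix.transpose_mul, Matrix.transpose_mul, ← Matrix.mul_assoc]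
    exact mem_cosetOf_minus (fun _ _ h => hk _ _ h) (fun _ _ h => hg _ _ h)
      (isUnit_transpose' k.isUnit) (isUnit_transpose' g.isUnit)

end Necessity

/-! ### The order conditions make the cell nonempty -/

lemma cell_nonempty_of_subsetLE {m n t : ℕ} {w₁ w₂ : Matrix (Fin m) (Fin n) ℂ}
    (hw₁ : IsPartialPerm w₁) (hw₂ : IsPartialPerm w₂) (hr₁ : w₁.rank = t) (hr₂ : w₂.rank = t)
    (hd : SubsetLE (dom w₁) (dom w₂)) (hr : SubsetLE (rng w₂) (rng w₁)) :
    (cell w₁ w₂).Nonempty := by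
  have cr₁ := hw₁.card_rng_eq_rank.trans hr₁
  have cr₂ := hw₂.card_rng_eq_rank.trans hr₂
  have cd₁ := hw₁.card_dom_eq_rank.trans hr₁
  have cd₂ := hw₂.card_dom_eq_rank.trans hr₂
  rw [subsetLE_iff cd₁ cd₂] at hd
  rw [subsetLE_iff cr₂ cr₁] at hr
  have e₁ := hw₁.eq_incl_mul cr₁ cd₁
  have e₂ := hw₂.eq_incl_mul cr₂ cd₂
  obtain ⟨b₁, u₁, b₂, u₂, hb₁, hu₁, hb₂, hu₂, hb₁', hu₁', hb₂', hu₂', e⟩ :=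
    exists_doubleBruhat _ _ (hw₁.isUnit_submatrix cr₁ cd₁) (hw₂.isUnit_submatrix cr₂ cd₂)
  set a₁ := (rng w₁).orderEmbOfFin cr₁
  set a₂ := (rng w₂).orderEmbOfFin cr₂
  set c₁ := (dom w₁).orderEmbOfFin cd₁
  set c₂ := (dom w₂).orderEmbOfFin cd₂
  have hA := shear_mul_incl a₁.injective a₂.injective
  have hC : (incl c₁)ᵀ * (shear c₁ c₂)ᵀ = (incl c₂)ᵀ * (shear c₂ c₁)ᵀ := by
    rw [← Matrix.transpose_mul, ← Matrix.transpose_mul,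
      shear_mul_incl c₁.injective c₂.injective]
  have regroup : ∀ {a : Fin t → Fin m} {c : Fin t → Fin n}, Function.Injective a →
      Function.Injective c → ∀ (g : Matrix (Fin m) (Fin m) ℂ) (k : Matrix (Fin n) (Fin n) ℂ)
      (b S u : Matrix (Fin t) (Fin t) ℂ),
      g * incl a * (b * S * u) * ((incl c)ᵀ * k) =
        g * extend a b * (incl a * S * (incl c)ᵀ) * (extend c u * k) := by
    intro a c ha hc g k b S u
    calc _ = g * (incl a * b) * S * (u * (incl c)ᵀ) * k := by simp only [Matrix.mul_assoc]
      _ = _ := by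
        rw [← extend_mul_incl ha, ← transpose_incl_mul_extend hc]
        simp only [Matrix.mul_assoc]
  -- A point of the `t × t` cell, placed between row and column embeddings that have the same form
  -- for `w₁` and `w₂` by `hA` and `hC`.
  refine ⟨shear a₁ a₂ * incl a₁ * (b₁ * w₁.submatrix a₁ c₁ * u₁) *
    ((incl c₁)ᵀ * (shear c₁ c₂)ᵀ), ?_, ?_⟩
  · rw [regroup a₁.injective c₁.injective, ← e₁]
    exact mem_cosetOf_plus ((shear_upper hr).mul (extend_upper a₁.strictMono hb₁))
      ((extend_upper c₁.strictMono hu₁).mul (shear_lower hd))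
      ((isUnit_shear_upper hr).mul (isUnit_extend a₁.injective hb₁'))
      ((isUnit_extend c₁.injective hu₁').mul (isUnit_transpose' (isUnit_shear_lower hd)))
  · rw [hA, hC, e, regroup a₂.injective c₂.injective, ← e₂]
    refine mem_cosetOf_minus ?_ ?_
      ((isUnit_shear_lower hr).mul (isUnit_extend a₂.injective hb₂'))
      ((isUnit_extend c₂.injective hu₂').mul (isUnit_transpose' (isUnit_shear_upper hd)))
    · rw [Matrix.transpose_mul, extend_transpose]
      exact (extend_upper a₂.strictMono hb₂).mul (shear_lower hr)
    · rw [Matrix.transpose_mul, Matrix.transpose_transpose, extend_transpose]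
      exact (shear_upper hd).mul (extend_upper c₂.strictMono hu₂)

end DoubleBruhat

theorem corollary7p7 (m n t : ℕ) (w₁ w₂ : Matrix (Fin m) (Fin n) ℂ)
    (hw₁ : DoubleBruhat.IsPartialPerm w₁) (hw₂ : DoubleBruhat.IsPartialPerm w₂)
    (hr₁ : w₁.rank = t) (hr₂ : w₂.rank = t) :
    (DoubleBruhat.cell w₁ w₂).Nonempty ↔
      DoubleBruhat.SubsetLE (DoubleBruhat.dom w₁) (DoubleBruhat.dom w₂) ∧
        DoubleBruhat.SubsetLE (DoubleBruhat.rng w₂) (DoubleBruhat.rng w₁) := by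
  open DoubleBruhat in
  refine ⟨fun h => ⟨?_, subsetLE_rng_of_cell_nonempty hw₁ hw₂ h⟩,
    fun h => cell_nonempty_of_subsetLE hw₁ hw₂ hr₁ hr₂ h.1 h.2⟩
  have := DoubleBruhat.subsetLE_rng_of_cell_nonempty hw₂.transpose hw₁.transpose
    (DoubleBruhat.cell_transpose_nonempty h)
  rwa [DoubleBruhat.rng_transpose, DoubleBruhat.rng_transpose] at this
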